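/- Let $\mathrm{Ch}$ be the category of cochain complexes of $\mathbb{Q}$-vector spaces in degrees $\ge 0$, and let $p\mathrm{Ch}=\mathrm{Fun}([0,\infty),\mathrm{Ch})$ be the category of persistent cochain complexes, where $[0,\infty)$ is regarded as a poset. For $k\ge 0$ let $S^k$ be $\mathbb{Q}$ in degree $k$; let $D^k$ (for $k\geq 1$) be $\mathbb{Q}\xrightarrow{=}\mathbb{Q}$ in degrees $k-1,k$, and $D^0=0$. For $0\le s\le t\le\infty$ let $\mathbb{S}^k_{[s,t)}$ be $0$ at indices $r<s$, $S^k$ at $s\le r<t$ and $D^k$ at $r\ge t$, and for $0\le s<\infty$ let $\mathbb{D}^k_s$ be $0$ at $r<s$ and $D^k$ at $r\ge s$, with the evident structure maps; put $\mathbb{D}^k_\infty=0$. The interval-sphere model structure on $p\mathrm{Ch}$ has the pointwise quasi-isomorphisms as weak equivalences and is cofibrantly generated by $$\mathbb{I}=\{\mathbb{S}^k_{[s,t)}\to\mathbb{D}^k_s \mid k\ge 0,\ 0\le s<t\le\infty\},\qquad \mathbb{J}=\{\mathbb{D}^k_t\to\mathbb{D}^k_s\mid k\ge 0,\ 0\le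 s<t\le\infty\};$$ thus its cofibrations are the maps with the left lifting property against every map that has the right lifting property against $\mathbb{I}$, and its fibrations are the maps with the right lifting property against $\mathbb{J}$. The injective model structure on $p\mathrm{Ch}$ has as weak equivalences and cofibrations the maps that are pointwise weak equivalences, respectively cofibrations, of the projective model structure on $\mathrm{Ch}$ (weak equivalences the quasi-isomorphisms, fibrations the degreewise surjections); its fibrations are the maps with the right lifting property against the maps that are both. A right-closed point of a persistence module $\mathbb{V}:[0,\infty)\to\mathrm{Vec}_{\mathbb{Q}}$ is a nonzero element $v\in\mathbb{V}(r)$, for some $r\geq 0$, with $\mathbb{V}(r\le r')(v)=0$ for all $r'>r$. Then: 1. If $\mathbb{Y}\in p\mathrm{Ch}$ and, for some $k>0$, the persistence module $\mathbb{Y}^k$ contains a right-closed point, then $\mathbb{Y}$ is not cofibrant in the interval-sphere model structure. 2. For all $0\le s\le t<\infty$ and $k>0$, the closed interval $\mathbb{I}_{[s,t]}\otimes S^k$ (the complex which in degree $k$ is $\mathbb{Q}$ at the indices in $[s,t]$ with identity structure maps, and is zero elsewhere) is not cofibrant in the interval-sphere model structure. 3. Every object of $p\mathrm{Ch}$ is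 cofibrant in the injective model structure. Consequently the interval-sphere and the injective model structures have different classes of cofibrations, and so they are different model structures. -/

import Mathlib

open CategoryTheory CategoryTheory.Limits
open scoped NNReal ENNReal ZeroObject

noncomputable section

namespace PersistentComplex

/-- Persistence modules: functors from the poset `[0, ∞)` to rational vector spaces. -/
abbrev PVec : Type 1 := ℝ≥0 ⥤ ModuleCat.{0} ℚ

/-- Cochain complexes of rational vector spaces in degrees `≥ 0`. -/
abbrev Ch : Type 1 := CochainComplex (ModuleCat.{0} ℚ) ℕ

/-- Persistent cochain complexes: functors from the poset `[0, ∞)` to cochain complexes. -/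
abbrev PCh : Type 1 := ℝ≥0 ⥤ Ch

/-- The persistence module `𝕐^k` of `k`-cochains of a persistent cochain complex `𝕐`. -/
def cochains (Y : PCh) (k : ℕ) : PVec :=
  Y ⋙ HomologicalComplex.eval (ModuleCat.{0} ℚ) (ComplexShape.up ℕ) k

/-- `v ∈ V(r)` is a right-closed point: it is nonzero and every structure map to a strictly
later index kills it. -/
def IsRightClosed (V : PVec) (r : ℝ≥0) (v : V.obj r) : Prop :=
  v ≠ 0 ∧ ∀ (r' : ℝ≥0) (h : r < r'), V.map (homOfLE h.le) v = 0

/-! ### Interval modules -/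

/-- The fibre at `r` of the interval module of `I`: it is `ℚ` if `r ∈ I`, and `0` otherwise. -/
def intervalFiber (I : Set ℝ≥0) (r : ℝ≥0) : Submodule ℚ ℚ where
  carrier := {q | r ∉ I → q = 0}
  zero_mem' := fun _ => rfl
  add_mem' := fun ha hb h => by rw [ha h, hb h, add_zero]
  smul_mem' := fun c x hx h => by rw [hx h, smul_zero]

open Classical in
/-- The map between two fibres (of possibly different interval modules) that is the identity
of `ℚ` if both fibres are `ℚ`, and zero otherwise. -/
def fiberMap (I J : Set ℝ≥0) (r r' : ℝ≥0) : intervalFiber I r →ₗ[ℚ] intervalFiber J r' where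
  toFun q := ⟨if r' ∈ J then q.1 else 0, fun h => if_neg h⟩
  map_add' a b := by
    ext
    by_cases h : r' ∈ J <;> simp [h]
  map_smul' c a := by
    ext
    by_cases h : r' ∈ J <;> simp [h]

lemma fiberMap_self (I : Set ℝ≥0) (r : ℝ≥0) : fiberMap I I r r = LinearMap.id := by
  apply LinearMap.ext
  intro q
  apply Subtype.ext
  by_cases h : r ∈ I
  · simp [fiberMap, h]
  · simp [fiberMap, h, q.2 h]

lemma fiberMap_comp {I J K : Set ℝ≥0} {r r' r'' : ℝ≥0} (h : r ∈ I → r'' ∈ K → r' ∈ J) :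
    fiberMap J K r' r'' ∘ₗ fiberMap I J r r' = fiberMap I K r r'' := by
  apply LinearMap.ext
  intro q
  apply Subtype.ext
  by_cases h'' : r'' ∈ K
  · by_cases h' : r' ∈ J
    · simp [fiberMap, h', h'']
    · simp [fiberMap, h', h'', q.2 (fun h1 => h' (h h1 h''))]
  · simp [fiberMap, h'']

/-- The interval module `𝕀_I` of an interval `I ⊆ [0, ∞)`: it is `ℚ` over the points of `I` and
`0` elsewhere; the structure maps between points of `I` are identities, the others are zero. -/
def intervalModule (I : Set ℝ≥0) (hI : I.OrdConnected) : PVec where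
  obj r := ModuleCat.of ℚ (intervalFiber I r)
  map {r r'} _ := ModuleCat.ofHom (fiberMap I I r r')
  map_id r := by rw [fiberMap_self]; rfl
  map_comp {r r' r''} f g := by
    rw [← ModuleCat.ofHom_comp,
      fiberMap_comp (fun h h'' => hI.out h h'' ⟨leOfHom f, leOfHom g⟩)]

/-- The ray `[t, ∞)` in `[0, ∞)`; it is empty for `t = ∞`. -/
def ray (t : ℝ≥0∞) : Set ℝ≥0 := {r | t ≤ (r : ℝ≥0∞)}

lemma ray_ordConnected (t : ℝ≥0∞) : (ray t).OrdConnected :=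
  ⟨fun _ hx _ _ _ hz => le_trans (show t ≤ _ from hx) (ENNReal.coe_le_coe.2 hz.1)⟩

/-- The half-open interval `[s, t)` in `[0, ∞)`, where `t = ∞` is allowed. -/
def halfOpen (s t : ℝ≥0∞) : Set ℝ≥0 := {r | s ≤ (r : ℝ≥0∞) ∧ (r : ℝ≥0∞) < t}

lemma halfOpen_ordConnected (s t : ℝ≥0∞) : (halfOpen s t).OrdConnected :=
  ⟨fun _ hx _ hy _ hz => ⟨le_trans (show s ≤ _ from hx.1) (ENNReal.coe_le_coe.2 hz.1),
    lt_of_le_of_lt (ENNReal.coe_le_coe.2 hz.2) (show _ < t from hy.2)⟩⟩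

/-- The free persistence module `𝕀_{[t, ∞)}`, which is zero for `t = ∞`. -/
def rayModule (t : ℝ≥0∞) : PVec := intervalModule (ray t) (ray_ordConnected t)

/-- The inclusion `𝕀_{[t, ∞)} ↪ 𝕀_{[s, ∞)}` for `s ≤ t ≤ ∞`. -/
def rayInclusion {s t : ℝ≥0∞} (hst : s ≤ t) : rayModule t ⟶ rayModule s where
  app r := ModuleCat.ofHom (fiberMap (ray t) (ray s) r r)
  naturality r r' f := by
    dsimp only [rayModule, intervalModule]
    rw [← ModuleCat.ofHom_comp, ← ModuleCat.ofHom_comp,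
      fiberMap_comp (J := ray t)
        (fun h _ => le_trans (show t ≤ _ from h) (ENNReal.coe_le_coe.2 (leOfHom f))),
      fiberMap_comp (J := ray s) (fun h _ => le_trans hst (show t ≤ _ from h))]

/-- The closed interval module `𝕀_{[s, t]}`. -/
def closedIntervalModule (s t : ℝ≥0) : PVec := intervalModule (Set.Icc s t) Set.ordConnected_Icc

/-- `V ⊗ S^k`: the persistent cochain complex with the persistence module `V` in degree `k` and
zero in all other degrees. -/
def tensorSphere (V : PVec) (k : ℕ) : PCh :=
  V ⋙ HomologicalComplex.single (ModuleCat.{0} ℚ) (ComplexShape.up ℕ) k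

/-! ### Interval spheres and persistent disks -/

lemma upRel (k : ℕ) : (ComplexShape.up ℕ).Rel k (k + 1) := rfl

/-- The persistent cochain complex with `A` in degree `k`, `B` in degree `k + 1`, and with
differential `f : A ⟶ B` between them; all other degrees are zero. -/
def twoTerm {A B : PVec} (f : A ⟶ B) (k : ℕ) : PCh :=
  (HomologicalComplex.double f (upRel k)).asFunctor

/-- The map of two-term persistent complexes given by a commutative square. -/
def twoTermMap {A B A' B' : PVec} {f : A ⟶ B} {f' : A' ⟶ B'} (a : A ⟶ A') (b : B ⟶ B')
    (comm : a ≫ f' = f ≫ b) (k : ℕ) : twoTerm f k ⟶ twoTerm f' k :=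
  HomologicalComplex.complexOfFunctorsToFunctorToComplex.map
    (HomologicalComplex.mkHomFromDouble (upRel k) (Nat.succ_ne_self k).symm
      (a ≫ (HomologicalComplex.doubleXIso₀ f' (upRel k)).inv)
      (b ≫ (HomologicalComplex.doubleXIso₁ f' (upRel k) (Nat.succ_ne_self k).symm).inv)
      (by
        rw [HomologicalComplex.double_d f' (upRel k) (Nat.succ_ne_self k).symm]
        simp only [Category.assoc, Iso.inv_hom_id_assoc]
        rw [← Category.assoc, comm, Category.assoc])
      (fun l _ => by
        rw [HomologicalComplex.double_d_eq_zero₀ f' (upRel k) _ _ (Nat.succ_ne_self k),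
          comp_zero]))

/-- The interval sphere `𝕊^k_{[s,t)}`, for `s ≤ t ≤ ∞`: it is `0` at indices `r < s`, the sphere
complex `S^k` at indices `s ≤ r < t`, and the disk complex `D^k` at indices `t ≤ r`, with the
evident inclusions as structure maps. For `k ≥ 1` it is therefore the complex of persistence
modules `𝕀_{[t,∞)} ↪ 𝕀_{[s,∞)}` in degrees `k - 1` and `k`; for `k = 0`, where `D^0 = 0`, it is
`𝕀_{[s,t)}` in degree `0`. -/
def intervalSphere : (k : ℕ) → {s t : ℝ≥0∞} → s ≤ t → PCh
  | 0, s, t, _ => tensorSphere (intervalModule (halfOpen s t) (halfOpen_ordConnected s t)) 0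
  | k + 1, _, _, h => twoTerm (rayInclusion h) k

/-- The persistent disk `𝔻^k_s`: it is `0` at indices `r < s` and the disk complex `D^k` at
indices `s ≤ r`. Here `D^k` is the identity of `ℚ` in degrees `k - 1` and `k` for `k ≥ 1`, and
`D^0 = 0`. For `s = ∞` the persistent disk is zero. -/
def persistentDisk : ℕ → ℝ≥0∞ → PCh
  | 0, _ => 0
  | k + 1, s => twoTerm (𝟙 (rayModule s)) k

/-- The inclusion `𝕊^k_{[s,t)} ⟶ 𝔻^k_s` (the zero map for `k = 0`). -/
def sphereToDisk : (k : ℕ) → {s t : ℝ≥0∞} → (h : s ≤ t) →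
    (intervalSphere k h ⟶ persistentDisk k s)
  | 0, _, _, _ => 0
  | k + 1, _, _, h => twoTermMap (rayInclusion h) (𝟙 _) rfl k

/-- The inclusion `𝔻^k_t ⟶ 𝔻^k_s` for `s ≤ t`; for `t = ∞` its source is zero. -/
def diskToDisk : (k : ℕ) → {s t : ℝ≥0∞} → s ≤ t → (persistentDisk k t ⟶ persistentDisk k s)
  | 0, _, _, _ => 0
  | k + 1, _, _, h => twoTermMap (rayInclusion h) (rayInclusion h)
      (by rw [Category.comp_id, Category.id_comp]) k

/-- Indices of the generating maps: a degree `k` and endpoints `0 ≤ s < t ≤ ∞`. -/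
structure GeneratorIndex where
  k : ℕ
  s : ℝ≥0
  t : ℝ≥0∞
  lt : (s : ℝ≥0∞) < t

/-- The generating cofibrations `𝕀`: the maps `𝕊^k_{[s,t)} ⟶ 𝔻^k_s`, `0 ≤ s < t ≤ ∞`. -/
def generatingCofibrations : MorphismProperty PCh :=
  MorphismProperty.ofHoms (fun a : GeneratorIndex => sphereToDisk a.k a.lt.le)

/-- The generating trivial cofibrations `𝕁`: the maps `𝔻^k_t ⟶ 𝔻^k_s`, `0 ≤ s < t < ∞`, and
`0 ⟶ 𝔻^k_s`, `0 ≤ s < ∞` (the case `t = ∞`). -/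
def generatingTrivialCofibrations : MorphismProperty PCh :=
  MorphismProperty.ofHoms (fun a : GeneratorIndex => diskToDisk a.k a.lt.le)

/-! ### The two model structures -/

/-- The three distinguished classes of maps of a model structure. -/
structure ModelClasses (C : Type*) [Category C] where
  weakEquivalences : MorphismProperty C
  cofibrations : MorphismProperty C
  fibrations : MorphismProperty C

/-- An object is cofibrant if the map to it from the initial object is a cofibration. -/
def ModelClasses.IsCofibrant {C : Type*} [Category C] [HasInitial C] (M : ModelClasses C)
    (X : C) : Prop :=
  M.cofibrations (initial.to X)

/-- The projective model structure on cochain complexes: the weak equivalences are the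
quasi-isomorphisms, the fibrations are the degreewise surjective maps, and the cofibrations are
the maps with the left lifting property against the trivial fibrations. -/
def projectiveStructure : ModelClasses Ch where
  weakEquivalences := HomologicalComplex.quasiIso (ModuleCat.{0} ℚ) (ComplexShape.up ℕ)
  cofibrations := MorphismProperty.llp (fun _ _ f =>
    (∀ n, Function.Surjective (f.f n)) ∧
      HomologicalComplex.quasiIso (ModuleCat.{0} ℚ) (ComplexShape.up ℕ) f)
  fibrations := fun _ _ f => ∀ n, Function.Surjective (f.f n)

/-- The pointwise quasi-isomorphisms of persistent cochain complexes. -/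
def pointwiseQuasiIso : MorphismProperty PCh :=
  fun _ _ f => ∀ r : ℝ≥0, projectiveStructure.weakEquivalences (f.app r)

/-- The pointwise cofibrations of persistent cochain complexes. -/
def pointwiseCofibrations : MorphismProperty PCh :=
  fun _ _ f => ∀ r : ℝ≥0, projectiveStructure.cofibrations (f.app r)

/-- The interval-sphere model structure on persistent cochain complexes: the model structure
with the pointwise quasi-isomorphisms as weak equivalences that is cofibrantly generated by `𝕀`
and `𝕁`. Its cofibrations are the maps with the left lifting property against all `𝕀`-injective
maps, and its fibrations are the `𝕁`-injective maps. -/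
def intervalSphereStructure : ModelClasses PCh where
  weakEquivalences := pointwiseQuasiIso
  cofibrations := generatingCofibrations.rlp.llp
  fibrations := generatingTrivialCofibrations.rlp

/-- The injective model structure on persistent cochain complexes: weak equivalences and
cofibrations are pointwise, and the fibrations are the maps with the right lifting property
against the trivial cofibrations. -/
def injectiveStructure : ModelClasses PCh where
  weakEquivalences := pointwiseQuasiIso
  cofibrations := pointwiseCofibrations
  fibrations := (pointwiseCofibrations ⊓ pointwiseQuasiIso).rlp

end PersistentComplex

end

noncomputable section

namespace PersistentComplex

lemma exists_generalizedInverse {A B : ModuleCat.{0} ℚ} (f : A ⟶ B) :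
    ∃ g : B ⟶ A, f ≫ g ≫ f = f := by
  obtain ⟨u, hu⟩ := f.hom.rangeRestrict.exists_rightInverse_of_surjective
    f.hom.range_rangeRestrict
  obtain ⟨g, hg⟩ := LinearMap.exists_extend u
  refine ⟨ModuleCat.ofHom g, ?_⟩
  ext x
  have h1 : g (f.hom x) = u (f.hom.rangeRestrict x) := LinearMap.congr_fun hg (f.hom.rangeRestrict x)
  have h2 := congrArg Subtype.val (LinearMap.congr_fun hu (f.hom.rangeRestrict x))
  change f.hom (g (f.hom x)) = f.hom x
  rw [h1]
  exact h2

lemma exists_eq_d_of_acyclic {K : Ch} (hK : K.Acyclic) (n : ℕ) (x : K.X (n + 1))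
    (hx : K.d (n + 1) (n + 2) x = 0) : ∃ z : K.X n, K.d n (n + 1) z = x := by
  have h := (K.exactAt_iff' n (n + 1) (n + 2) (by simp) (by simp)).1 (hK (n + 1))
  rw [ShortComplex.moduleCat_exact_iff] at h
  exact h x hx

lemma eq_zero_of_acyclic {K : Ch} (hK : K.Acyclic) (x : K.X 0)
    (hx : K.d 0 1 x = 0) : x = 0 := by
  have h := (K.exactAt_iff' 0 0 1 (by simp) (by simp)).1 (hK 0)
  rw [ShortComplex.moduleCat_exact_iff] at h
  obtain ⟨z, hz⟩ := h x hx
  rw [← hz]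
  change K.d 0 0 z = 0
  rw [K.shape 0 0 (by simp)]
  rfl

/-- An acyclic complex of rational vector spaces in degrees `≥ 0` is contractible. -/
lemma exists_contraction {K : Ch} (hK : K.Acyclic) :
    ∃ h : ∀ n, K.X (n + 1) ⟶ K.X n, K.d 0 1 ≫ h 0 = 𝟙 _ ∧
      ∀ n, h n ≫ K.d n (n + 1) + K.d (n + 1) (n + 2) ≫ h (n + 1) = 𝟙 _ := by
  choose g hg using fun n => exists_generalizedInverse (K.d n (n + 1))
  refine ⟨fun n => (𝟙 _ - K.d (n + 1) (n + 2) ≫ g (n + 1)) ≫ g n, ?_, fun n => ?_⟩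
  · have h0 : 𝟙 _ - K.d 0 1 ≫ g 0 = 0 := by
      ext x
      refine eq_zero_of_acyclic hK _ ?_
      rw [← ConcreteCategory.comp_apply, Preadditive.sub_comp, Category.assoc, hg 0]
      simp
    rw [← Category.assoc, Preadditive.comp_sub]
    simp only [Category.comp_id, HomologicalComplex.d_comp_d_assoc, zero_comp, sub_zero]
    exact (sub_eq_zero.1 h0).symm
  · have h1 : (𝟙 _ - K.d (n + 1) (n + 2) ≫ g (n + 1)) ≫ g n ≫ K.d n (n + 1) =
        𝟙 _ - K.d (n + 1) (n + 2) ≫ g (n + 1) := by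
      ext x
      obtain ⟨z, hz⟩ := exists_eq_d_of_acyclic hK n
        ((𝟙 _ - K.d (n + 1) (n + 2) ≫ g (n + 1) : K.X (n + 1) ⟶ _) x) (by
          rw [← ConcreteCategory.comp_apply, Preadditive.sub_comp, Category.assoc, hg (n + 1)]
          simp)
      rw [ConcreteCategory.comp_apply, ← hz, ← ConcreteCategory.comp_apply, hg n]
    rw [Category.assoc, h1, ← Category.assoc, Preadditive.comp_sub]
    simp

/-- A surjective quasi-isomorphism of complexes of rational vector spaces has a section. -/
lemma exists_section {A B : Ch} (p : A ⟶ B) (hp : ∀ n, Function.Surjective (p.f n))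
    (hq : QuasiIso p) : ∃ σ : B ⟶ A, σ ≫ p = 𝟙 B := by
  have hepi : ∀ n, Epi (p.f n) := fun n => (ModuleCat.epi_iff_surjective _).2 (hp n)
  have hepi' : Epi p := HomologicalComplex.epi_of_epi_f p hepi
  have hS : (ShortComplex.mk (kernel.ι p) p (kernel.condition p)).ShortExact :=
    { exact := ShortComplex.exact_kernel p }
  obtain ⟨h, h0, hh⟩ := exists_contraction (hS.acyclic_X₁ hq)
  dsimp only at h h0 hh
  have hdeg n := (HomologicalComplex.shortExact_iff_degreewise_shortExact _).1 hS n
  have hmono n : Mono ((kernel.ι p).f n) := (hdeg n).mono_f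
  have hip n : (kernel.ι p).f n ≫ p.f n = 0 := by
    rw [← HomologicalComplex.comp_f, kernel.condition, HomologicalComplex.zero_f]
  have hsec n : ∃ s : B.X n ⟶ A.X n, s ≫ p.f n = 𝟙 _ := by
    obtain ⟨u, hu⟩ := (p.f n).hom.exists_rightInverse_of_surjective
      (LinearMap.range_eq_top.2 (hp n))
    exact ⟨ModuleCat.ofHom u, ModuleCat.hom_ext hu⟩
  choose s hs using hsec
  have hδ n : ∃ δ : B.X n ⟶ (kernel p).X (n + 1), δ ≫ (kernel.ι p).f (n + 1) =
      s n ≫ A.d n (n + 1) - B.d n (n + 1) ≫ s (n + 1) := by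
    have := (hdeg (n + 1)).mono_f
    refine ⟨(hdeg (n + 1)).exact.lift (s n ≫ A.d n (n + 1) - B.d n (n + 1) ≫ s (n + 1)) ?_,
      (hdeg (n + 1)).exact.lift_f _ _⟩
    change (s n ≫ A.d n (n + 1) - B.d n (n + 1) ≫ s (n + 1)) ≫ p.f (n + 1) = 0
    rw [Preadditive.sub_comp, Category.assoc, Category.assoc, hs, ← p.comm,
      ← Category.assoc, hs]
    simp
  choose δ hδ using hδ
  have hδd n : δ n ≫ (kernel p).d (n + 1) (n + 2) = - B.d n (n + 1) ≫ δ (n + 1) := by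
    rw [← cancel_mono ((kernel.ι p).f (n + 2)), Category.assoc,
      ← (kernel.ι p).comm, ← Category.assoc, hδ, Preadditive.neg_comp, Category.assoc, hδ]
    simp
  refine ⟨{ f := fun n => s n - δ n ≫ h n ≫ (kernel.ι p).f n, comm' := ?_ }, ?_⟩
  · rintro n _ rfl
    have e : δ n ≫ h n ≫ (kernel p).d n (n + 1) =
        δ n + B.d n (n + 1) ≫ δ (n + 1) ≫ h (n + 1) := by
      have := congrArg (δ n ≫ ·) (hh n)
      simp only [Preadditive.comp_add, Category.comp_id] at this
      rw [← Category.assoc (δ n) ((kernel p).d _ _), hδd] at this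
      rw [Preadditive.neg_comp, Category.assoc, ← sub_eq_add_neg] at this
      exact sub_eq_iff_eq_add.1 this
    rw [Preadditive.sub_comp, Preadditive.comp_sub, Category.assoc, Category.assoc,
      (kernel.ι p).comm, ← Category.assoc (h n), ← Category.assoc (δ n), e,
      Preadditive.add_comp, hδ]
    simp only [Category.assoc]
    abel
  · ext1 n
    rw [HomologicalComplex.comp_f, Preadditive.sub_comp, hs, Category.assoc, Category.assoc, hip]
    simp

lemma pointwiseCofibrations_initial_to (Y : PCh) : pointwiseCofibrations (initial.to Y) := by
  rintro r A B p ⟨hp, hq⟩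
  obtain ⟨σ, hσ⟩ := exists_section p hp hq
  have h0 : IsZero ((⊥_ PCh).obj r) :=
    (Functor.isZero_iff _).1 ((initialIsInitial (C := PCh)).isZero) r
  exact ⟨fun {u v} sq => ⟨⟨⟨v ≫ σ, h0.eq_of_src _ _, by rw [Category.assoc, hσ, Category.comp_id]⟩⟩⟩⟩

/-- The differential of the complex with `M` in degrees `k - 1` and `k`. -/
def diskDifferential (k : ℕ) (M : ModuleCat.{0} ℚ) (i j : ℕ) :
    (PLift (i = k ∨ i + 1 = k) → M) →ₗ[ℚ] (PLift (j = k ∨ j + 1 = k) → M) where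
  toFun f := fun _ => if h : i + 1 = k ∧ j = k then f ⟨Or.inr h.1⟩ else 0
  map_add' f g := by
    ext p
    by_cases h : i + 1 = k ∧ j = k <;> simp [h]
  map_smul' c f := by
    ext p
    by_cases h : i + 1 = k ∧ j = k <;> simp [h]

lemma diskDifferential_pos {k i j : ℕ} (M : ModuleCat.{0} ℚ) (h : i + 1 = k ∧ j = k)
    (f : PLift (i = k ∨ i + 1 = k) → M) (p : PLift (j = k ∨ j + 1 = k)) :
    diskDifferential k M i j f p = f ⟨Or.inr h.1⟩ := dif_pos h

lemma diskDifferential_neg {k i j : ℕ} (M : ModuleCat.{0} ℚ) (h : ¬ (i + 1 = k ∧ j = k))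
    (f : PLift (i = k ∨ i + 1 = k) → M) (p : PLift (j = k ∨ j + 1 = k)) :
    diskDifferential k M i j f p = 0 := dif_neg h

/-- The complex with `M` in degrees `k - 1` and `k` (only in degree `0` if `k = 0`), with
identity differential. -/
def diskComplex (k : ℕ) (M : ModuleCat.{0} ℚ) : Ch where
  X i := ModuleCat.of ℚ (PLift (i = k ∨ i + 1 = k) → M)
  d i j := ModuleCat.ofHom (diskDifferential k M i j)
  shape i j hij := ModuleCat.hom_ext <| LinearMap.ext fun f => funext fun p =>
    diskDifferential_neg M (fun h => hij (h.1.trans h.2.symm)) f p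
  d_comp_d' i j l _ _ := ModuleCat.hom_ext <| LinearMap.ext fun f => funext fun p => by
    change diskDifferential k M j l (diskDifferential k M i j f) p = 0
    by_cases h : j + 1 = k ∧ l = k
    · rw [diskDifferential_pos M h, diskDifferential_neg M (by omega)]
    · rw [diskDifferential_neg M h]

/-- The functor `M ↦ D^k ⊗ M`. -/
def diskFunctor (k : ℕ) : ModuleCat.{0} ℚ ⥤ Ch where
  obj := diskComplex k
  map {M N} φ :=
    { f := fun i => ModuleCat.ofHom (LinearMap.pi fun p => φ.hom ∘ₗ LinearMap.proj p)
      comm' := fun i j _ => ModuleCat.hom_ext <| LinearMap.ext fun f => funext fun p => by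
        change diskDifferential k N i j (fun p => φ.hom (f p)) p =
          φ.hom (diskDifferential k M i j f p)
        by_cases h : i + 1 = k ∧ j = k
        · rw [diskDifferential_pos _ h]
          exact congrArg φ.hom (diskDifferential_pos M h f p).symm
        · rw [diskDifferential_neg _ h]
          exact (map_zero φ.hom).symm.trans (congrArg φ.hom (diskDifferential_neg M h f p).symm) }
  map_id M := by ext; rfl
  map_comp f g := by ext; rfl

/-- The components of the chain map to `D^k ⊗ M` that corresponds to `g : Y^k ⟶ M`. -/
def toDiskComponent (k : ℕ) (Y : Ch) {M : ModuleCat.{0} ℚ} (g : Y.X k ⟶ M) (i : ℕ) : Y.X i ⟶ M :=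
  if h : i = k then (Y.XIsoOfEq h).hom ≫ g else Y.d i k ≫ g

lemma toDiskComponent_self (k : ℕ) (Y : Ch) {M : ModuleCat.{0} ℚ} (g : Y.X k ⟶ M) :
    toDiskComponent k Y g k = g := by
  simp [toDiskComponent]

lemma toDiskComponent_of_ne (k : ℕ) (Y : Ch) {M : ModuleCat.{0} ℚ} (g : Y.X k ⟶ M) {i : ℕ}
    (h : i ≠ k) : toDiskComponent k Y g i = Y.d i k ≫ g := by
  simp [toDiskComponent, h]

/-- The chain map to `D^k ⊗ M` that corresponds to `g : Y^k ⟶ M`. -/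
def toDisk (k : ℕ) (Y : Ch) {M : ModuleCat.{0} ℚ} (g : Y.X k ⟶ M) : Y ⟶ diskComplex k M where
  f i := ModuleCat.ofHom (LinearMap.pi fun _ => (toDiskComponent k Y g i).hom)
  comm' := by
    rintro i _ rfl
    refine ModuleCat.hom_ext <| LinearMap.ext fun y => funext fun ⟨p⟩ => ?_
    change diskDifferential k M i (i + 1) (fun _ => toDiskComponent k Y g i y) ⟨p⟩ =
      toDiskComponent k Y g (i + 1) (Y.d i (i + 1) y)
    by_cases h : i + 1 = k
    · rw [diskDifferential_pos _ ⟨h, h⟩]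
      subst h
      rw [toDiskComponent_self, toDiskComponent_of_ne _ _ _ (Nat.succ_ne_self i).symm]
      rfl
    · rw [diskDifferential_neg _ (by omega), toDiskComponent_of_ne _ _ _ h,
        ← ConcreteCategory.comp_apply, Y.d_comp_d_assoc, zero_comp]
      rfl

/-- Maps into `D^k ⊗ M` correspond to maps from the `k`-cochains to `M`. -/
def diskHomEquiv (k : ℕ) (Y : Ch) (M : ModuleCat.{0} ℚ) :
    (Y.X k ⟶ M) ≃ (Y ⟶ diskComplex k M) where
  toFun g := toDisk k Y g
  invFun φ := φ.f k ≫ ModuleCat.ofHom (LinearMap.proj ⟨Or.inl rfl⟩)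
  left_inv g := by
    ext y
    change toDiskComponent k Y g k y = g y
    rw [toDiskComponent_self]
  right_inv φ := by
    ext1 i
    refine ModuleCat.hom_ext <| LinearMap.ext fun y => funext fun ⟨p⟩ => ?_
    change toDiskComponent k Y _ i y = φ.f i y ⟨p⟩
    by_cases h : i = k
    · subst h
      rw [toDiskComponent_self]
      rfl
    · obtain rfl : i + 1 = k := p.resolve_left h
      rw [toDiskComponent_of_ne _ _ _ h]
      refine (congrFun (ConcreteCategory.congr_hom (φ.comm i (i + 1)) y) ⟨Or.inl rfl⟩).symm.trans ?_
      exact diskDifferential_pos M ⟨rfl, rfl⟩ _ ⟨Or.inl rfl⟩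

/-- Evaluation in degree `k` is left adjoint to `M ↦ D^k ⊗ M`. -/
def evalDiskAdjunction (k : ℕ) :
    HomologicalComplex.eval (ModuleCat.{0} ℚ) (ComplexShape.up ℕ) k ⊣ diskFunctor k :=
  Adjunction.mkOfHomEquiv
    { homEquiv := diskHomEquiv k
      homEquiv_naturality_left_symm := fun _ _ => rfl
      homEquiv_naturality_right := fun {Y M M'} f g => by
        refine ((diskHomEquiv k Y M').symm_apply_eq.1 ?_).symm
        exact congrArg (fun u : Y.X k ⟶ M => u ≫ g) ((diskHomEquiv k Y M).symm_apply_apply f) }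

/-- The functor of `k`-cochains of persistent complexes is left adjoint to `M ↦ D^k ⊗ M`. -/
def cochainsDiskAdjunction (k : ℕ) :=
  (evalDiskAdjunction k).whiskerRight ℝ≥0

lemma mem_ray {t : ℝ≥0} {r : ℝ≥0} : r ∈ ray t ↔ t ≤ r := ENNReal.coe_le_coe

/-- The generator of a free persistence module. -/
def rayGenerator (t : ℝ≥0) : (rayModule t).obj t :=
  (⟨1, fun h => (h (mem_ray.2 le_rfl)).elim⟩ : intervalFiber (ray t) t)

lemma rayModule_eq_zero {t : ℝ≥0∞} {r : ℝ≥0} (h : r ∉ ray t) (x : (rayModule t).obj r) :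
    x = 0 :=
  Subtype.ext ((show intervalFiber (ray t) r from x).2 h)

lemma rayModule_eq_smul {t r : ℝ≥0} (h : t ≤ r) (x : (rayModule t).obj r) :
    x = (show intervalFiber (ray t) r from x).1 • (rayModule t).map (homOfLE h) (rayGenerator t) := by
  apply Subtype.ext
  exact (mul_one _).symm.trans (congrArg (_ * ·) (if_pos (mem_ray.2 h)).symm)

lemma rayModule_hom_ext {t : ℝ≥0} {V : PVec} {f g : rayModule t ⟶ V}
    (h : f.app t (rayGenerator t) = g.app t (rayGenerator t)) : f = g := by
  ext r x
  by_cases hr : t ≤ r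
  · rw [rayModule_eq_smul hr x, map_smul, map_smul, NatTrans.naturality_apply,
      NatTrans.naturality_apply, h]
  · rw [rayModule_eq_zero (mt mem_ray.1 hr) x, map_zero, map_zero]

lemma rayModule_top_hom_ext {V : PVec} {f g : rayModule ⊤ ⟶ V} : f = g := by
  ext r x
  rw [rayModule_eq_zero (t := ⊤) (fun h => ENNReal.coe_ne_top (top_le_iff.1 h)) x, map_zero, map_zero]

/-- The components of the map from a free persistence module that sends the generator to `m`. -/
def rayHomComponent {t : ℝ≥0} {V : PVec} (m : V.obj t) (r : ℝ≥0) :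
    intervalFiber (ray t) r →ₗ[ℚ] V.obj r :=
  if h : t ≤ r then (LinearMap.toSpanSingleton ℚ (V.obj r) (V.map (homOfLE h) m)).comp
    (intervalFiber (ray t) r).subtype else 0

lemma rayHomComponent_apply {t : ℝ≥0} {V : PVec} (m : V.obj t) {r : ℝ≥0} (h : t ≤ r)
    (x : intervalFiber (ray t) r) : rayHomComponent m r x = x.1 • V.map (homOfLE h) m := by
  rw [rayHomComponent, dif_pos h]
  rfl

/-- The map from a free persistence module that sends the generator to `m`. -/
def rayHom {t : ℝ≥0} {V : PVec} (m : V.obj t) : rayModule t ⟶ V where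
  app r := ModuleCat.ofHom (rayHomComponent m r)
  naturality r r' f := by
    refine ModuleCat.hom_ext <| LinearMap.ext fun (x : intervalFiber (ray t) r) => ?_
    change rayHomComponent m r' (fiberMap (ray t) (ray t) r r' x) =
      V.map f (rayHomComponent m r x)
    by_cases h : t ≤ r
    · have h' := h.trans (leOfHom f)
      rw [rayHomComponent_apply m h, rayHomComponent_apply m h', map_smul,
        ← ConcreteCategory.comp_apply, ← V.map_comp]
      exact congrArg (· • _) (if_pos (mem_ray.2 h'))
    · obtain rfl : x = 0 := rayModule_eq_zero (mt mem_ray.1 h) x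
      simp only [map_zero]

lemma rayHom_generator {t : ℝ≥0} {V : PVec} (m : V.obj t) :
    (rayHom m).app t (rayGenerator t) = m := by
  refine (rayHomComponent_apply m le_rfl _).trans ?_
  change (1 : ℚ) • V.map (𝟙 t) m = m
  rw [one_smul, V.map_id]
  rfl

lemma rayInclusion_generator {s t : ℝ≥0} (h : (s : ℝ≥0∞) ≤ t) :
    (rayInclusion h).app t (rayGenerator t) =
      (rayModule s).map (homOfLE (ENNReal.coe_le_coe.1 h)) (rayGenerator s) := rfl

/-- Inclusions of free persistence modules have the left lifting property against surjections
whose kernel has surjective structure maps. -/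
lemma rayInclusion_hasLiftingProperty {V W : PVec} (q : V ⟶ W)
    (hq : ∀ r, Function.Surjective (q.app r))
    (hker : ∀ (r t : ℝ≥0) (h : r ≤ t) (x : V.obj t), q.app t x = 0 →
      ∃ z : V.obj r, q.app r z = 0 ∧ V.map (homOfLE h) z = x)
    {s : ℝ≥0} {t : ℝ≥0∞} (h : (s : ℝ≥0∞) ≤ t) : HasLiftingProperty (rayInclusion h) q where
  sq_hasLift {a b} sq := by
    obtain ⟨x, hx⟩ := hq s (b.app s (rayGenerator s))
    induction t with
    | top =>
      refine ⟨⟨rayHom x, rayModule_top_hom_ext, rayModule_hom_ext ?_⟩⟩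
      rw [NatTrans.comp_app, ConcreteCategory.comp_apply, rayHom_generator, hx]
    | coe t =>
      have hst : s ≤ t := ENNReal.coe_le_coe.1 h
      obtain ⟨z, hz, hz'⟩ := hker s t hst
        (a.app t (rayGenerator t) - V.map (homOfLE hst) x) (by
          have e := ConcreteCategory.congr_hom (NatTrans.congr_app sq.w t) (rayGenerator t)
          rw [NatTrans.comp_app, NatTrans.comp_app, ConcreteCategory.comp_apply,
            ConcreteCategory.comp_apply, rayInclusion_generator, NatTrans.naturality_apply] at e
          rw [map_sub, NatTrans.naturality_apply, hx, e, sub_self])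
      refine ⟨⟨rayHom (x + z), rayModule_hom_ext ?_, rayModule_hom_ext ?_⟩⟩
      · rw [NatTrans.comp_app, ConcreteCategory.comp_apply, rayInclusion_generator,
          NatTrans.naturality_apply, rayHom_generator, map_add, hz', add_sub_cancel]
      · rw [NatTrans.comp_app, ConcreteCategory.comp_apply, rayHom_generator, map_add, hx, hz,
          add_zero]

/-- The functor of `k`-cochains of persistent complexes. -/
def cochainsFunctor (k : ℕ) : PCh ⥤ PVec :=
  (Functor.whiskeringRight ℝ≥0 Ch (ModuleCat.{0} ℚ)).obj
    (HomologicalComplex.eval (ModuleCat.{0} ℚ) (ComplexShape.up ℕ) k)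

lemma hasLiftingProperty_of_isZero {C : Type*} [Category C] {A B X Y : C} (i : A ⟶ B) (p : X ⟶ Y)
    (hA : IsZero A) (hB : IsZero B) : HasLiftingProperty i p :=
  have : IsIso i := ⟨hB.to_ A, hA.eq_of_src _ _, hB.eq_of_src _ _⟩
  inferInstance

lemma twoTermMap_hasLiftingProperty {A B A' B' V W : PVec} {f : A ⟶ B} {f' : A' ⟶ B'}
    (a : A ⟶ A') (b : B ⟶ B') (comm : a ≫ f' = f ≫ b) (j : ℕ) (q : V ⟶ W)
    [HasLiftingProperty a q] [HasLiftingProperty b q] (k : ℕ) :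
    HasLiftingProperty ((cochainsFunctor k).map (twoTermMap a b comm j)) q := by
  by_cases h0 : k = j
  · subst h0
    refine HasLiftingProperty.of_arrow_iso_left
      (Arrow.isoMk (HomologicalComplex.doubleXIso₀ f (upRel k)).symm
        (HomologicalComplex.doubleXIso₀ f' (upRel k)).symm ?_ :
        Arrow.mk a ≅ Arrow.mk ((cochainsFunctor k).map (twoTermMap a b comm k))) q
    change (HomologicalComplex.doubleXIso₀ f (upRel k)).inv ≫
      (HomologicalComplex.mkHomFromDouble _ _ _ _ _ _).f k = a ≫ _
    rw [HomologicalComplex.mkHomFromDouble_f₀, Iso.inv_hom_id_assoc]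
    rfl
  by_cases h1 : k = j + 1
  · subst h1
    have hne : j ≠ j + 1 := (Nat.succ_ne_self j).symm
    refine HasLiftingProperty.of_arrow_iso_left
      (Arrow.isoMk (HomologicalComplex.doubleXIso₁ f (upRel j) hne).symm
        (HomologicalComplex.doubleXIso₁ f' (upRel j) hne).symm ?_ :
        Arrow.mk b ≅ Arrow.mk ((cochainsFunctor (j + 1)).map (twoTermMap a b comm j))) q
    change (HomologicalComplex.doubleXIso₁ f (upRel j) hne).inv ≫
      (HomologicalComplex.mkHomFromDouble _ _ _ _ _ _).f (j + 1) = b ≫ _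
    rw [HomologicalComplex.mkHomFromDouble_f₁, Iso.inv_hom_id_assoc]
    rfl
  · exact hasLiftingProperty_of_isZero _ _
      (HomologicalComplex.isZero_double_X f (upRel j) k h0 h1)
      (HomologicalComplex.isZero_double_X f' (upRel j) k h0 h1)

lemma isZero_cochains_tensorSphere (V : PVec) {j k : ℕ} (h : k ≠ j) :
    IsZero ((cochainsFunctor k).obj (tensorSphere V j)) :=
  Functor.isZero _ fun r =>
    HomologicalComplex.isZero_single_obj_X (ComplexShape.up ℕ) j (V.obj r) k h

/-- In positive degrees the generating cofibrations have the left lifting property against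
surjections whose kernel has surjective structure maps. -/
lemma cochains_sphereToDisk_hasLiftingProperty {V W : PVec} (q : V ⟶ W)
    (hq : ∀ r, Function.Surjective (q.app r))
    (hker : ∀ (r t : ℝ≥0) (h : r ≤ t) (x : V.obj t), q.app t x = 0 →
      ∃ z : V.obj r, q.app r z = 0 ∧ V.map (homOfLE h) z = x)
    {k : ℕ} (hk : 0 < k) (j : ℕ) {s : ℝ≥0} {t : ℝ≥0∞} (h : (s : ℝ≥0∞) ≤ t) :
    HasLiftingProperty ((cochainsFunctor k).map (sphereToDisk j h)) q := by
  cases j with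
  | zero =>
    exact hasLiftingProperty_of_isZero _ _ (isZero_cochains_tensorSphere _ hk.ne')
      (Functor.isZero _ fun r => Functor.map_isZero
        (HomologicalComplex.eval (ModuleCat.{0} ℚ) (ComplexShape.up ℕ) k)
        (IsZero.obj (isZero_zero PCh) r))
  | succ j =>
    have := rayInclusion_hasLiftingProperty q hq hker h
    exact twoTermMap_hasLiftingProperty _ _ rfl j q k

open Classical in
/-- The truncation at `r`, on pairs of a number attached to `s` and a sequence whose `n`-th term
is attached to `s + 1 / (n + 1)`: it kills the number if `s < r`, and the terms attached to
points that are at most `r`. -/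
def truncation (s r : ℝ≥0) : ℚ × (ℕ → ℚ) →ₗ[ℚ] ℚ × (ℕ → ℚ) where
  toFun x := (if r ≤ s then x.1 else 0, fun n => if s + 1 / ((n : ℝ≥0) + 1) ≤ r then 0 else x.2 n)
  map_add' x y := by
    ext n
    · by_cases h : r ≤ s <;> simp [h]
    · by_cases h : s + 1 / ((n : ℝ≥0) + 1) ≤ r <;>
        simp only [h, if_true, if_false, Prod.snd_add, Pi.add_apply, add_zero]
  map_smul' c x := by
    ext n
    · by_cases h : r ≤ s <;> simp [h]
    · by_cases h : s + 1 / ((n : ℝ≥0) + 1) ≤ r <;>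
        simp only [h, if_true, if_false, Prod.smul_snd, Pi.smul_apply, smul_zero, RingHom.id_apply]

lemma truncation_truncation {s r r' : ℝ≥0} (h : r ≤ r') (x : ℚ × (ℕ → ℚ)) :
    truncation s r' (truncation s r x) = truncation s r' x := by
  refine Prod.ext ?_ (funext fun n => ?_)
  · change (if r' ≤ s then (if r ≤ s then x.1 else 0) else 0) = (if r' ≤ s then x.1 else 0)
    split_ifs with h1 h2
    · rfl
    · exact (h2 (h.trans h1)).elim
    · rfl
  · change (if _ then (0 : ℚ) else (if _ then 0 else x.2 n)) = (if _ then 0 else x.2 n)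
    split_ifs with h1 h2
    · rfl
    · exact (h1 (h2.trans h)).elim
    · rfl

lemma truncation_truncation' {s r r' : ℝ≥0} (h : r ≤ r') (x : ℚ × (ℕ → ℚ)) :
    truncation s r (truncation s r' x) = truncation s r' x := by
  refine Prod.ext ?_ (funext fun n => ?_)
  · change (if r ≤ s then (if r' ≤ s then x.1 else 0) else 0) = (if r' ≤ s then x.1 else 0)
    split_ifs with h1 h2 h3
    · rfl
    · rfl
    · exact (h1 (h.trans h3)).elim
    · rfl
  · change (if _ then (0 : ℚ) else (if _ then 0 else x.2 n)) = (if _ then 0 else x.2 n)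
    split_ifs with h1 h2 h3
    · rfl
    · exact (h2 (h1.trans h)).elim
    · rfl
    · rfl

/-- The fibre at `r` of the extension of `𝕀_{[0, s]}` by `⨁ₙ 𝕀_{[0, s + 1 / (n + 1))}`: sequences
together with their eventual value, truncated at `r`. -/
def eventuallyConstantFiber (s r : ℝ≥0) : Submodule ℚ (ℚ × (ℕ → ℚ)) where
  carrier := {x | (∃ N, ∀ n ≥ N, x.2 n = x.1) ∧ truncation s r x = x}
  zero_mem' := ⟨⟨0, fun _ _ => rfl⟩, map_zero _⟩
  add_mem' := by
    rintro x y ⟨⟨N, hN⟩, hx⟩ ⟨⟨N', hN'⟩, hy⟩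
    refine ⟨⟨max N N', fun n hn => ?_⟩, by rw [map_add, hx, hy]⟩
    rw [Prod.snd_add, Pi.add_apply, hN n (le_of_max_le_left hn), hN' n (le_of_max_le_right hn)]
    rfl
  smul_mem' := by
    rintro c x ⟨⟨N, hN⟩, hx⟩
    refine ⟨⟨N, fun n hn => ?_⟩, by rw [map_smul, hx]⟩
    rw [Prod.smul_snd, Pi.smul_apply, hN n hn]
    rfl

lemma truncation_mem {s r r' : ℝ≥0} {x : ℚ × (ℕ → ℚ)} (hx : x ∈ eventuallyConstantFiber s r) :
    truncation s r' x ∈ eventuallyConstantFiber s r' := by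
  refine ⟨?_, truncation_truncation le_rfl x⟩
  obtain ⟨⟨N, hN⟩, -⟩ := hx
  by_cases h : r' ≤ s
  · refine ⟨N, fun n hn => ?_⟩
    have h1 : ¬ (s + 1 / ((n : ℝ≥0) + 1) ≤ r') := fun h2 =>
      absurd (h2.trans h) (not_le.2 (lt_add_of_pos_right s (by positivity)))
    change (if _ then 0 else x.2 n) = (if _ then x.1 else 0)
    rw [if_neg h1, if_pos h, hN n hn]
  · push Not at h
    obtain ⟨N', hN'⟩ := exists_nat_one_div_lt (tsub_pos_of_lt h)
    refine ⟨N', fun n hn => ?_⟩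
    have h1 : s + 1 / ((n : ℝ≥0) + 1) ≤ r' := by
      have h2 : 1 / ((n : ℝ≥0) + 1) ≤ 1 / ((N' : ℝ≥0) + 1) := by
        have : (N' : ℝ≥0) ≤ n := Nat.cast_le.2 hn
        gcongr
      calc s + 1 / ((n : ℝ≥0) + 1) ≤ s + (r' - s) := by
            gcongr
            exact h2.trans hN'.le
        _ = r' := add_tsub_cancel_of_le h.le
    change (if _ then 0 else x.2 n) = (if _ then x.1 else 0)
    rw [if_pos h1, if_neg (not_le.2 h)]

/-- The extension of `𝕀_{[0, s]}` by `⨁ₙ 𝕀_{[0, s + 1 / (n + 1))}` whose elements are truncated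
eventually constant sequences. -/
def eventuallyConstantModule (s : ℝ≥0) : PVec where
  obj r := ModuleCat.of ℚ (eventuallyConstantFiber s r)
  map {r r'} _ := ModuleCat.ofHom ((truncation s r').restrict (fun _ hx => truncation_mem hx))
  map_id r := by
    exact ModuleCat.hom_ext <| LinearMap.ext fun (x : eventuallyConstantFiber s r) =>
      Subtype.ext x.2.2
  map_comp {r r' r''} f g := by
    exact ModuleCat.hom_ext <| LinearMap.ext fun (x : eventuallyConstantFiber s r) =>
      Subtype.ext (truncation_truncation (leOfHom g) x.1).symm

/-- The map to `𝕀_{[0, s]}` that sends an eventually constant sequence to its eventual value. -/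
def eventualValue (s : ℝ≥0) :
    eventuallyConstantModule s ⟶ intervalModule (Set.Iic s) Set.ordConnected_Iic where
  app r := ModuleCat.ofHom
    ((LinearMap.fst ℚ ℚ (ℕ → ℚ)).restrict (p := eventuallyConstantFiber s r)
      (q := intervalFiber (Set.Iic s) r) (fun x hx h => by
        rw [← hx.2]
        exact if_neg h))
  naturality r r' f := by
    ext x
    rfl

lemma eventualValue_surjective (s r : ℝ≥0) : Function.Surjective ((eventualValue s).app r) := by
  intro c
  by_cases h : r ≤ s
  · refine ⟨(⟨((show intervalFiber (Set.Iic s) r from c).1,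
      fun _ => (show intervalFiber (Set.Iic s) r from c).1), ⟨0, fun _ _ => rfl⟩,
      Prod.ext (if_pos h) (funext fun n => if_neg fun h2 => ?_)⟩ : eventuallyConstantFiber s r),
      rfl⟩
    exact absurd (h2.trans h) (not_le.2 (lt_add_of_pos_right s (by positivity)))
  · refine ⟨0, ?_⟩
    rw [map_zero]
    exact Subtype.ext ((show intervalFiber (Set.Iic s) r from c).2 h).symm

lemma exists_lift_in_ker_eventualValue (s r t : ℝ≥0) (h : r ≤ t)
    (x : (eventuallyConstantModule s).obj t) (hx : (eventualValue s).app t x = 0) :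
    ∃ z : (eventuallyConstantModule s).obj r, (eventualValue s).app r z = 0 ∧
      (eventuallyConstantModule s).map (homOfLE h) z = x := by
  obtain ⟨x, hx1, hx2⟩ := x
  refine ⟨(⟨x, hx1, ?_⟩ : eventuallyConstantFiber s r), ?_, Subtype.ext hx2⟩
  · rw [← hx2, truncation_truncation' h]
  · have h0 : x.1 = 0 := congrArg Subtype.val hx
    exact Subtype.ext h0

/-- An element of the module of eventually constant sequences that dies immediately after `s` has
eventual value `0`. -/
lemma eventualValue_eq_zero (s : ℝ≥0) (x : (eventuallyConstantModule s).obj s)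
    (hx : ∀ (r : ℝ≥0) (h : s < r), (eventuallyConstantModule s).map (homOfLE h.le) x = 0) :
    (eventualValue s).app s x = 0 := by
  obtain ⟨x, ⟨N, hN⟩, hx2⟩ := x
  refine Subtype.ext ?_
  change x.1 = 0
  rw [← hN N le_rfl]
  have h := congrFun (congrArg (fun z => (Subtype.val z).2)
    (hx (s + 1 / (N + 1 + 1)) (lt_add_of_pos_right s (by positivity)))) N
  change (if s + 1 / ((N : ℝ≥0) + 1) ≤ s + 1 / (N + 1 + 1) then 0 else x.2 N) = 0 at h
  rwa [if_neg] at h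
  rw [not_le]
  gcongr
  exact lt_add_one _

/-- The components of the map to `𝕀_{[0, s]}` given by a linear functional on the fibre at `s`. -/
def ofFunctionalComponent {V : PVec} {s : ℝ≥0} (l : V.obj s →ₗ[ℚ] ℚ) (r : ℝ≥0) :
    V.obj r →ₗ[ℚ] intervalFiber (Set.Iic s) r :=
  if h : r ≤ s then (l ∘ₗ (V.map (homOfLE h)).hom).codRestrict (intervalFiber (Set.Iic s) r)
    (fun _ hn => (hn h).elim) else 0

lemma ofFunctionalComponent_apply {V : PVec} {s : ℝ≥0} (l : V.obj s →ₗ[ℚ] ℚ) {r : ℝ≥0}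
    (h : r ≤ s) (x : V.obj r) : (ofFunctionalComponent l r x).1 = l (V.map (homOfLE h) x) := by
  rw [ofFunctionalComponent, dif_pos h]
  rfl

/-- The map to `𝕀_{[0, s]}` given by a linear functional on the fibre at `s`. -/
def ofFunctional {V : PVec} {s : ℝ≥0} (l : V.obj s →ₗ[ℚ] ℚ) :
    V ⟶ intervalModule (Set.Iic s) Set.ordConnected_Iic where
  app r := ModuleCat.ofHom (ofFunctionalComponent l r)
  naturality r r' f := by
    refine ModuleCat.hom_ext <| LinearMap.ext fun x => Subtype.ext ?_
    by_cases h : r' ≤ s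
    · have h' : r ≤ s := (leOfHom f).trans h
      refine (ofFunctionalComponent_apply l h (V.map f x)).trans ?_
      rw [← ConcreteCategory.comp_apply, ← V.map_comp]
      exact (ofFunctionalComponent_apply l h' x).symm.trans (if_pos (Set.mem_Iic.2 h)).symm
    · exact ((ofFunctionalComponent l r' (V.map f x)).2 h).trans (if_neg h).symm

lemma ofFunctional_app_ne_zero {V : PVec} {s : ℝ≥0} (l : V.obj s →ₗ[ℚ] ℚ) (y : V.obj s)
    (hy : l y ≠ 0) : (ofFunctional l).app s y ≠ 0 := by
  intro h
  apply hy
  have h' := (ofFunctionalComponent_apply l le_rfl y).symm.trans (congrArg Subtype.val h)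
  change l (V.map (𝟙 s) y) = 0 at h'
  rwa [V.map_id] at h'

/-- A persistent complex whose `k`-cochains contain a right-closed point, where `k > 0`, is not
cofibrant in the interval-sphere model structure. -/
lemma not_isCofibrant_of_isRightClosed (Y : PCh) {k : ℕ} (hk : 0 < k) {s : ℝ≥0}
    {y : (cochains Y k).obj s} (hy : IsRightClosed (cochains Y k) s y) :
    ¬ intervalSphereStructure.IsCofibrant Y := by
  intro hY
  have hrlp : generatingCofibrations.rlp
      (((Functor.whiskeringRight ℝ≥0 (ModuleCat.{0} ℚ) Ch).obj (diskFunctor k)).map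
        (eventualValue s)) := by
    intro _ _ _ hi
    obtain ⟨a⟩ := hi
    exact ((cochainsDiskAdjunction k).hasLiftingProperty_iff _ _).1
      (cochains_sphereToDisk_hasLiftingProperty _ (eventualValue_surjective s)
        (exists_lift_in_ker_eventualValue s) hk a.k a.lt.le)
  have : HasLiftingProperty ((cochainsFunctor k).map (initial.to Y)) (eventualValue s) :=
    ((cochainsDiskAdjunction k).hasLiftingProperty_iff _ _).2 (hY _ hrlp)
  have hI : IsZero ((cochainsFunctor k).obj (⊥_ PCh)) := Functor.isZero _ fun r =>
    Functor.map_isZero (HomologicalComplex.eval (ModuleCat.{0} ℚ) (ComplexShape.up ℕ) k)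
      (IsZero.obj ((initialIsInitial (C := PCh)).isZero) r)
  obtain ⟨l, hl⟩ := not_forall.1 (mt (Module.forall_dual_apply_eq_zero_iff ℚ y).1 hy.1)
  have sq : CommSq (hI.to_ _) ((cochainsFunctor k).map (initial.to Y)) (eventualValue s)
    (ofFunctional (V := (cochainsFunctor k).obj Y) l) := ⟨hI.eq_of_src _ _⟩
  have hfac := NatTrans.congr_app sq.fac_right s
  refine ofFunctional_app_ne_zero (V := (cochainsFunctor k).obj Y) l y hl ?_
  rw [← hfac]
  refine eventualValue_eq_zero s _ fun r h => ?_
  refine (NatTrans.naturality_apply sq.lift (homOfLE h.le) y).symm.trans ?_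
  exact (congrArg (sq.lift.app r) (hy.2 r h)).trans (map_zero (sq.lift.app r).hom)

lemma exists_isRightClosed_closedInterval {s t : ℝ≥0} (h : s ≤ t) (k : ℕ) :
    ∃ y, IsRightClosed (cochains (tensorSphere (closedIntervalModule s t) k) k) t y := by
  let e (r : ℝ≥0) := HomologicalComplex.singleObjXSelf (ComplexShape.up ℕ) k
    ((closedIntervalModule s t).obj r)
  let x : (closedIntervalModule s t).obj t :=
    (⟨1, fun hn => (hn ⟨h, le_rfl⟩).elim⟩ : intervalFiber (Set.Icc s t) t)
  refine ⟨(e t).inv x, fun h0 => ?_, fun r hr => ?_⟩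
  · have h1 : (e t).hom ((e t).inv x) = x := by
      rw [← ConcreteCategory.comp_apply, Iso.inv_hom_id]; rfl
    rw [h0] at h1
    exact one_ne_zero (congrArg Subtype.val (h1.symm.trans (map_zero (e t).hom.hom)))
  · have hx : (closedIntervalModule s t).map (homOfLE hr.le) x = 0 :=
      Subtype.ext (if_neg fun hm => not_le.2 hr hm.2)
    have hn : (e t).inv ≫ (cochains (tensorSphere (closedIntervalModule s t) k) k).map
        (homOfLE hr.le) = (closedIntervalModule s t).map (homOfLE hr.le) ≫ (e r).inv := by
      change (e t).inv ≫ ((HomologicalComplex.single _ _ k).map _).f k = _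
      rw [HomologicalComplex.single_map_f_self, Iso.inv_hom_id_assoc]
    refine (ConcreteCategory.congr_hom hn x).trans ?_
    exact (congrArg (e r).inv hx).trans (map_zero (e r).inv.hom)

lemma not_isCofibrant_closedInterval {s t : ℝ≥0} {k : ℕ} (h : s ≤ t) (hk : 0 < k) :
    ¬ intervalSphereStructure.IsCofibrant (tensorSphere (closedIntervalModule s t) k) :=
  have ⟨_, hy⟩ := exists_isRightClosed_closedInterval h k
  not_isCofibrant_of_isRightClosed _ hk hy

lemma cofibrations_ne :
    intervalSphereStructure.cofibrations ≠ injectiveStructure.cofibrations := fun h =>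
  not_isCofibrant_closedInterval (le_refl 0) one_pos <| by
    rw [ModelClasses.IsCofibrant, h]
    exact pointwiseCofibrations_initial_to _

end PersistentComplex

end

theorem mainTheorem5 :
    (∀ (Y : PersistentComplex.PCh) (k : ℕ), 0 < k →
      (∃ (s : ℝ≥0) (y : (PersistentComplex.cochains Y k).obj s),
        PersistentComplex.IsRightClosed (PersistentComplex.cochains Y k) s y) →
      ¬ PersistentComplex.intervalSphereStructure.IsCofibrant Y) ∧
    (∀ (s t : ℝ≥0) (k : ℕ), s ≤ t → 0 < k →
      ¬ PersistentComplex.intervalSphereStructure.IsCofibrant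
        (PersistentComplex.tensorSphere (PersistentComplex.closedIntervalModule s t) k)) ∧
    (∀ Y : PersistentComplex.PCh, PersistentComplex.injectiveStructure.IsCofibrant Y) ∧
    PersistentComplex.intervalSphereStructure.cofibrations ≠
      PersistentComplex.injectiveStructure.cofibrations ∧
    PersistentComplex.intervalSphereStructure ≠ PersistentComplex.injectiveStructure :=
  ⟨fun Y _ hk ⟨_, _, hy⟩ => PersistentComplex.not_isCofibrant_of_isRightClosed Y hk hy,
    fun _ _ _ h hk => PersistentComplex.not_isCofibrant_closedInterval h hk,
    PersistentComplex.pointwiseCofibrations_initial_to,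
    PersistentComplex.cofibrations_ne,
    fun h => PersistentComplex.cofibrations_ne (congrArg _ h)⟩
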